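/- Let $k$ be a field, let $h\ge 2$ be an integer, and let $$\Gamma_h=\langle m_0,m_1,m_2,m_3\rangle\subset\mathbb{N},\quad m_0=2h(2h-1),\ m_1=(2h+1)(2h-1),\ m_2=2h(2h+1),\ m_3=2h(2h+1)+(2h-1),$$ be the Bresinsky semigroup. Let $R=k[[\Gamma_h]]=k[[t^{m_0},t^{m_1},t^{m_2},t^{m_3}]]$, a local ring with maximal ideal $\mathfrak{m}$, and let $G_{\mathfrak m}(\Gamma_h)=\bigoplus_{n\ge 0}\mathfrak{m}^n/\mathfrak{m}^{n+1}$ be its tangent cone. Then every component $\mathfrak{m}^n/\mathfrak{m}^{n+1}$ is a finite-dimensional $k$-vector space, and the Hilbert series of $G_{\mathfrak m}(\Gamma_h)$ is $$\sum_{n\ge 0}\dim_k\left(\mathfrak{m}^n/\mathfrak{m}^{n+1}\right)x^n=\frac{\sum_{j=0}^{2h-2}(2j+1)x^{j}+(2h-1)x^{2h-1}}{1-x}.$$ -/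

import Mathlib

open PowerSeries

noncomputable section

/-- The Bresinsky semigroup `Γ_h`, generated by `m₀ = 2h(2h-1)`, `m₁ = (2h+1)(2h-1)`,
`m₂ = 2h(2h+1)` and `m₃ = 2h(2h+1) + (2h-1)` (used for `h ≥ 2`). -/
def bresinskySemigroup (h : ℕ) : AddSubmonoid ℕ :=
  AddSubmonoid.closure
    {2 * h * (2 * h - 1), (2 * h + 1) * (2 * h - 1), 2 * h * (2 * h + 1),
      2 * h * (2 * h + 1) + (2 * h - 1)}

/-- The ring `k[[Γ]]` of formal power series `∑_{s ∈ Γ} c_s t^s`, as a `k`-subalgebra of `k[[t]]`.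
When `Γ` is generated by `a₁, …, a_e` this is `k[[t^{a₁}, …, t^{a_e}]]`. -/
def semigroupPowerSeries (k : Type*) [Field k] (Γ : AddSubmonoid ℕ) : Subalgebra k k⟦X⟧ where
  carrier := {f | ∀ n, coeff n f ≠ 0 → n ∈ Γ}
  mul_mem' := by
    intro f g hf hg n hn
    rw [coeff_mul] at hn
    obtain ⟨p, hp, hne⟩ := Finset.exists_ne_zero_of_sum_ne_zero hn
    rw [← Finset.HasAntidiagonal.mem_antidiagonal.mp hp]
    exact Γ.add_mem (hf _ (left_ne_zero_of_mul hne)) (hg _ (right_ne_zero_of_mul hne))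
  add_mem' := by
    intro f g hf hg n hn
    by_cases h : coeff n f = 0
    · exact hg n (by simpa [h] using hn)
    · exact hf n h
  algebraMap_mem' := by
    intro c n hn
    have h0 : n = 0 := by
      by_contra h
      exact hn (by simp [PowerSeries.algebraMap_apply, coeff_C, h])
    exact h0 ▸ Γ.zero_mem

theorem semigroupPowerSeries_inv_mem {k : Type*} [Field k] {Γ : AddSubmonoid ℕ} {f : k⟦X⟧}
    (hf : f ∈ semigroupPowerSeries k Γ) : f⁻¹ ∈ semigroupPowerSeries k Γ := by
  intro n
  induction n using Nat.strong_induction_on with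
  | _ n ih =>
    intro hn
    by_cases h0 : n = 0
    · exact h0 ▸ Γ.zero_mem
    rw [PowerSeries.coeff_inv, if_neg h0] at hn
    obtain ⟨p, hp, hne⟩ := Finset.exists_ne_zero_of_sum_ne_zero (right_ne_zero_of_mul hn)
    split_ifs at hne with hlt
    · rw [← Finset.HasAntidiagonal.mem_antidiagonal.mp hp]
      exact Γ.add_mem (hf _ (left_ne_zero_of_mul hne)) (ih _ hlt (right_ne_zero_of_mul hne))
    · exact absurd rfl hne

theorem semigroupPowerSeries_isUnit_iff {k : Type*} [Field k] {Γ : AddSubmonoid ℕ}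
    (f : semigroupPowerSeries k Γ) : IsUnit f ↔ constantCoeff (f : k⟦X⟧) ≠ 0 := by
  constructor
  · intro hf
    exact ((hf.map (semigroupPowerSeries k Γ).val).map (constantCoeff (R := k))).ne_zero
  · intro hf
    exact IsUnit.of_mul_eq_one ⟨_, semigroupPowerSeries_inv_mem f.2⟩
      (Subtype.ext (PowerSeries.mul_inv_cancel _ hf))

instance semigroupPowerSeries_isLocalRing (k : Type*) [Field k] (Γ : AddSubmonoid ℕ) : IsLocalRing (semigroupPowerSeries k Γ) :=
  IsLocalRing.of_nonunits_add fun f g hf hg => by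
    simp only [mem_nonunits_iff, semigroupPowerSeries_isUnit_iff, not_not] at *
    simp [hf, hg]

/-- The maximal ideal of `k[[Γ]]` consists of the series with vanishing constant term. -/
theorem mem_maximalIdeal_semigroupPowerSeries {k : Type*} [Field k] {Γ : AddSubmonoid ℕ}
    (f : semigroupPowerSeries k Γ) :
    f ∈ IsLocalRing.maximalIdeal (semigroupPowerSeries k Γ) ↔ constantCoeff (f : k⟦X⟧) = 0 := by
  rw [IsLocalRing.mem_maximalIdeal, mem_nonunits_iff, semigroupPowerSeries_isUnit_iff, not_not]

/-- The homogeneous component of degree `n` of the tangent cone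
`G_𝔪(R) = ⨁ n, 𝔪 ^ n / 𝔪 ^ (n + 1)` of a local ring `(R, 𝔪)`: the quotient of `𝔪 ^ n` by its
submodule `𝔪 • 𝔪 ^ n = 𝔪 ^ (n + 1)`. -/
abbrev TangentConeComponent (R : Type*) [CommRing R] [IsLocalRing R] (n : ℕ) : Type _ :=
  ↥(IsLocalRing.maximalIdeal R ^ n) ⧸
    (IsLocalRing.maximalIdeal R • ⊤ : Submodule R ↥(IsLocalRing.maximalIdeal R ^ n))

/-- The Hilbert series `∑ n, (dim_k V_n) x^n` of a graded `k`-vector space `⨁ n, V n`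
(meaningful when every `V n` is finite-dimensional). -/
def hilbertSeries (k : Type*) [Field k] (V : ℕ → Type*) [∀ n, AddCommGroup (V n)]
    [∀ n, Module k (V n)] : ℤ⟦X⟧ :=
  PowerSeries.mk fun n => (Module.finrank k (V n) : ℤ)

end

/-! With `K = 2h - 1` the generators are `m₀ + e K + 2 d (K + 1)` for `e, d ∈ {0, 1}`, where `m₀ = K
(K + 1)`. Hence sums of `n` generators are exactly the values `n m₀ + i K + 2 j (K + 1)` with `i, j
≤ n` independent. Trading `K + 1` steps `K` for one `m₀`, or `K` steps `2 (K + 1)` for two, only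
increases the number of generators, so each element has a longest expression, with `i ≤ K` and `j <
K` (`exists_normal_form`). It is unique because `K` is odd (`gridValue_normal_form_unique`). Since
`𝔪 ^ n` consists of the series supported on sums of at least `n` generators
(`mem_maximalIdeal_pow_iff`), degree `n` has dimension `min (K + 1) (n + 1) * min K (n + 1)`, whose
successive differences form the numerator. -/

/-! ### Sums of generators and their normal form -/

/-- The sum of `n` generators of the Bresinsky semigroup with `K = 2h - 1` in which the step
`m₁ - m₀ = K` is used `i` times and the step `m₂ - m₀ = 2 (K + 1)` is used `j` times. -/
def gridValue (K n i j : ℕ) : ℕ := n * ((K + 1) * K) + i * K + 2 * j * (K + 1)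

/-- The elements which are sums of at least `n` generators of the Bresinsky semigroup. -/
def orderFiltration (K n : ℕ) : Set ℕ :=
  {s | ∃ m i j, n ≤ m ∧ i ≤ m ∧ j ≤ m ∧ gridValue K m i j = s}

theorem gridValue_mem_orderFiltration {K n m i j : ℕ} (hm : n ≤ m) (hi : i ≤ m) (hj : j ≤ m) :
    gridValue K m i j ∈ orderFiltration K n :=
  ⟨m, i, j, hm, hi, hj, rfl⟩

theorem orderFiltration_add_mem {K n n' s s' : ℕ} (hs : s ∈ orderFiltration K n)
    (hs' : s' ∈ orderFiltration K n') : s + s' ∈ orderFiltration K (n + n') := by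
  obtain ⟨m, i, j, hm, hi, hj, rfl⟩ := hs
  obtain ⟨m', i', j', hm', hi', hj', rfl⟩ := hs'
  refine ⟨m + m', i + i', j + j', by omega, by omega, by omega, ?_⟩
  simp only [gridValue]
  ring

theorem exists_lt_two_add_of_le_succ {a m : ℕ} (ha : a ≤ m + 1) :
    ∃ e b, e < 2 ∧ b ≤ m ∧ a = e + b := by
  rcases a with _ | a
  · exact ⟨0, 0, by omega, by omega, rfl⟩
  · exact ⟨1, a, by omega, by omega, by omega⟩

/-- The generators realise all four pairs in `{0, 1} × {0, 1}`, so `i` and `j` can be lowered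
independently while one generator is removed. -/
theorem exists_generator_add_of_mem_orderFiltration {K n s : ℕ}
    (hs : s ∈ orderFiltration K (n + 1)) :
    ∃ p ∈ (Finset.range 2 ×ˢ Finset.range 2 : Finset (ℕ × ℕ)), ∃ u ∈ orderFiltration K n,
      s = gridValue K 1 p.1 p.2 + u := by
  obtain ⟨m, i, j, hm, hi, hj, rfl⟩ := hs
  obtain ⟨m, rfl⟩ : ∃ l, m = l + 1 := ⟨m - 1, by omega⟩
  obtain ⟨e, i, he, hi', rfl⟩ := exists_lt_two_add_of_le_succ hi
  obtain ⟨d, j, hd, hj', rfl⟩ := exists_lt_two_add_of_le_succ hj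
  refine ⟨(e, d), by simp [he, hd], gridValue K m i j,
    gridValue_mem_orderFiltration (by omega) hi' hj', ?_⟩
  simp only [gridValue]
  ring

theorem generators_eq_gridValue {h : ℕ} (hh : 2 ≤ h) :
    2 * h * (2 * h - 1) = gridValue (2 * h - 1) 1 0 0 ∧
    (2 * h + 1) * (2 * h - 1) = gridValue (2 * h - 1) 1 1 0 ∧
    2 * h * (2 * h + 1) = gridValue (2 * h - 1) 1 0 1 ∧
    2 * h * (2 * h + 1) + (2 * h - 1) = gridValue (2 * h - 1) 1 1 1 := by
  obtain ⟨K, hK⟩ : ∃ K, 2 * h = K + 1 := ⟨2 * h - 1, by omega⟩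
  simp only [hK, gridValue, Nat.add_sub_cancel]
  refine ⟨?_, ?_, ?_, ?_⟩ <;> ring

theorem generator_mem_bresinskySemigroup {h : ℕ} (hh : 2 ≤ h) {e d : ℕ} (he : e < 2)
    (hd : d < 2) : gridValue (2 * h - 1) 1 e d ∈ bresinskySemigroup h := by
  obtain ⟨h0, h1, h2, h3⟩ := generators_eq_gridValue hh
  refine AddSubmonoid.subset_closure ?_
  rw [h3, h0, h1, h2]
  interval_cases e <;> interval_cases d <;> simp

theorem mem_bresinskySemigroup_iff {h : ℕ} (hh : 2 ≤ h) (s : ℕ) :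
    s ∈ bresinskySemigroup h ↔ s ∈ orderFiltration (2 * h - 1) 0 := by
  constructor
  · intro hs
    induction hs using AddSubmonoid.closure_induction with
    | mem x hx =>
      obtain ⟨h0, h1, h2, h3⟩ := generators_eq_gridValue hh
      rw [h3, h0, h1, h2] at hx
      rcases hx with rfl | rfl | rfl | rfl <;>
        exact gridValue_mem_orderFiltration (by omega) (by omega) (by omega)
    | zero => exact ⟨0, 0, 0, by simp [gridValue]⟩
    | add x y _ _ hx hy => exact orderFiltration_add_mem hx hy
  · rintro ⟨m, i, j, -, hi, hj, rfl⟩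
    induction m generalizing i j with
    | zero =>
      obtain rfl : i = 0 := by omega
      obtain rfl : j = 0 := by omega
      simp [gridValue]
    | succ m ih =>
      obtain ⟨e, i, he, hi', rfl⟩ := exists_lt_two_add_of_le_succ hi
      obtain ⟨d, j, hd, hj', rfl⟩ := exists_lt_two_add_of_le_succ hj
      have := add_mem (generator_mem_bresinskySemigroup hh he hd) (ih i j hi' hj')
      convert this using 1
      simp only [gridValue]
      ring

theorem mem_orderFiltration_one {K s : ℕ} (hs : s ∈ orderFiltration K 0) (h0 : s ≠ 0) :
    s ∈ orderFiltration K 1 := by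
  obtain ⟨m, i, j, -, hi, hj, rfl⟩ := hs
  refine gridValue_mem_orderFiltration ?_ hi hj
  by_contra hm
  obtain rfl : m = 0 := by omega
  obtain rfl : i = 0 := by omega
  obtain rfl : j = 0 := by omega
  simp [gridValue] at h0

theorem orderFiltration_antitone (K : ℕ) : Antitone (orderFiltration K) := by
  rintro a b hab _ ⟨m, i, j, hm, hi, hj, rfl⟩
  exact gridValue_mem_orderFiltration (by omega) hi hj

theorem exists_normal_form {K n s : ℕ} (hK : 0 < K) (hs : s ∈ orderFiltration K n) :
    ∃ T r q, n ≤ T ∧ r ≤ K ∧ q < K ∧ r ≤ T ∧ q ≤ T ∧ gridValue K T r q = s := by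
  obtain ⟨m, i, j, hm, hi, hj, rfl⟩ := hs
  have hr : i % (K + 1) < K + 1 := Nat.mod_lt _ (by omega)
  have hri := Nat.mod_le i (K + 1)
  have hqj := Nat.mod_le j K
  -- `(K + 1) K = m₀` and `K * 2 (K + 1) = 2 m₀` account for the two quotients.
  refine ⟨m + i / (K + 1) + 2 * (j / K), i % (K + 1), j % K, ?_, by omega,
    Nat.mod_lt _ hK, ?_, ?_, ?_⟩
  iterate 3
    generalize i / (K + 1) = a, j / K = b at *
    omega
  conv_rhs => rw [← Nat.div_add_mod i (K + 1), ← Nat.div_add_mod j K]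
  simp only [gridValue]
  ring

/-- Reduction modulo `K + 1` determines `r`, and reduction modulo `K` determines `q`, since `2 (K +
1)` is prime to the odd number `K`. -/
theorem gridValue_normal_form_unique {K T r q T' r' q' : ℕ} (hK : Odd K) (hr : r ≤ K)
    (hr' : r' ≤ K) (hq : q < K) (hq' : q' < K) (h : gridValue K T r q = gridValue K T' r' q') :
    T = T' ∧ r = r' ∧ q = q' := by
  have hc : Nat.Coprime K (K + 1) := by simp
  have hpos : 0 < K := hK.pos
  simp only [gridValue] at h
  have h1 : r = r' := by
    have hm : r * K ≡ r' * K [MOD (K + 1)] := by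
      have h' := congrArg (· % (K + 1)) h
      have e : ∀ T r q, T * ((K + 1) * K) + r * K + 2 * q * (K + 1)
          = r * K + (K + 1) * (T * K + 2 * q) := by intros; ring
      simp only [e, Nat.add_mul_mod_self_left] at h'
      exact h'
    exact Nat.ModEq.eq_of_lt_of_lt (Nat.ModEq.cancel_right_of_coprime (by simp) hm)
      (by omega) (by omega)
  have h2 : q = q' := by
    have hm : q * (2 * (K + 1)) ≡ q' * (2 * (K + 1)) [MOD K] := by
      have h' := congrArg (· % K) h
      have e : ∀ T r q, T * ((K + 1) * K) + r * K + 2 * q * (K + 1)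
          = q * (2 * (K + 1)) + K * (T * (K + 1) + r) := by intros; ring
      simp only [e, Nat.add_mul_mod_self_left] at h'
      exact h'
    have hc2 : Nat.gcd K (2 * (K + 1)) = 1 :=
      Nat.Coprime.mul_right (Nat.coprime_two_right.mpr hK) hc
    exact Nat.ModEq.eq_of_lt_of_lt (Nat.ModEq.cancel_right_of_coprime hc2 hm) hq hq'
  subst h1 h2
  have hne : 0 < (K + 1) * K := by positivity
  exact ⟨Nat.eq_of_mul_eq_mul_right hne (by omega), rfl, rfl⟩

/-! ### Powers of the maximal ideal -/

/-- A series supported in a finite union of translates `a + U` is a combination of the monomials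
`X ^ a` with coefficients supported in `U`. -/
theorem exists_eq_sum_X_pow_mul {k ι : Type*} [Field k] (S : Finset ι) (a : ι → ℕ) (U : Set ℕ)
    (f : k⟦X⟧) (hf : ∀ s, coeff s f ≠ 0 → ∃ p ∈ S, ∃ u ∈ U, s = a p + u) :
    ∃ c : ι → k⟦X⟧, (∀ p, ∀ s, coeff s (c p) ≠ 0 → s ∈ U) ∧ f = ∑ p ∈ S, X ^ a p * c p := by
  classical
  rcases isEmpty_or_nonempty ι with hι | hι
  · refine ⟨fun _ => 0, by simp, ?_⟩
    ext s
    by_contra h0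
    rw [Finset.eq_empty_of_isEmpty S] at h0
    obtain ⟨p, -⟩ := hf s (by simpa using h0)
    exact hι.elim p
  have hch : ∀ s, ∃ p, coeff s f ≠ 0 → p ∈ S ∧ ∃ u ∈ U, s = a p + u := by
    intro s
    by_cases h0 : coeff s f = 0
    · exact ⟨hι.some, fun h => absurd h0 h⟩
    · obtain ⟨p, hp⟩ := hf s h0
      exact ⟨p, fun _ => hp⟩
  -- Each exponent in the support is assigned to a single translate, so overlaps are not counted
  -- twice.
  choose g hg using hch
  refine ⟨fun p => mk fun m => if g (m + a p) = p then coeff (m + a p) f else 0, ?_, ?_⟩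
  · intro p s hs
    rw [coeff_mk] at hs
    split_ifs at hs with hgp
    · obtain ⟨_, u, hu, he⟩ := hg _ hs
      rw [hgp] at he
      obtain rfl : s = u := by omega
      exact hu
    · exact absurd rfl hs
  · ext s
    rw [map_sum]
    simp only [coeff_X_pow_mul', coeff_mk]
    by_cases h0 : coeff s f = 0
    · rw [h0]
      refine (Finset.sum_eq_zero fun p _ => ?_).symm
      split_ifs with h1 h2
      · rw [Nat.sub_add_cancel h1, h0]
      · rfl
      · rfl
    · obtain ⟨hp, u, hu, he⟩ := hg s h0
      rw [Finset.sum_eq_single_of_mem (g s) hp]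
      · rw [if_pos (by omega), Nat.sub_add_cancel (by omega), if_pos rfl]
      · intro p _ hne
        split_ifs with h1 h2
        · rw [Nat.sub_add_cancel h1] at h2
          exact absurd h2.symm hne
        · rfl
        · rfl

/-- The powers of the maximal ideal of `k[[Γ_h]]` are described by the supports of series. -/
theorem mem_maximalIdeal_pow_iff {k : Type*} [Field k] {h : ℕ} (hh : 2 ≤ h) (n : ℕ)
    (f : semigroupPowerSeries k (bresinskySemigroup h)) :
    f ∈ IsLocalRing.maximalIdeal (semigroupPowerSeries k (bresinskySemigroup h)) ^ n ↔
      ∀ s, coeff s (f : k⟦X⟧) ≠ 0 → s ∈ orderFiltration (2 * h - 1) n := by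
  constructor
  · induction n generalizing f with
    | zero => exact fun _ s hs => (mem_bresinskySemigroup_iff hh s).1 (f.2 s hs)
    | succ n ih =>
      intro hf
      rw [pow_succ] at hf
      induction hf using Submodule.mul_induction_on' with
      | mem_mul_mem a ha b hb =>
        intro s hs
        rw [MulMemClass.coe_mul, coeff_mul] at hs
        obtain ⟨p, hp, hne⟩ := Finset.exists_ne_zero_of_sum_ne_zero hs
        rw [← Finset.HasAntidiagonal.mem_antidiagonal.mp hp]
        refine orderFiltration_add_mem (ih a ha _ (left_ne_zero_of_mul hne)) ?_
        have hb0 := right_ne_zero_of_mul hne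
        refine mem_orderFiltration_one ((mem_bresinskySemigroup_iff hh _).1 (b.2 _ hb0)) ?_
        intro h0
        rw [h0] at hb0
        exact hb0 (by simpa using (mem_maximalIdeal_semigroupPowerSeries b).1 hb)
      | add a _ b _ ha hb =>
        intro s hs
        by_cases h0 : coeff s (a : k⟦X⟧) = 0
        · exact hb s (by simpa [h0] using hs)
        · exact ha s h0
  · induction n generalizing f with
    | zero => simp
    | succ n ih =>
      intro hf
      -- Splitting a generator off every exponent writes `f` as a finite sum of products in `𝔪 * 𝔪 ^
      -- n`, even when its support is infinite.
      obtain ⟨c, hc, hsum⟩ := exists_eq_sum_X_pow_mul (Finset.range 2 ×ˢ Finset.range 2)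
        (fun p : ℕ × ℕ => gridValue (2 * h - 1) 1 p.1 p.2) (orderFiltration (2 * h - 1) n)
        (f : k⟦X⟧) fun s hs => exists_generator_add_of_mem_orderFiltration (hf s hs)
      have hcR : ∀ p, c p ∈ semigroupPowerSeries k (bresinskySemigroup h) := fun p s hs =>
        (mem_bresinskySemigroup_iff hh s).2 (orderFiltration_antitone _ (Nat.zero_le n) (hc p s hs))
      have hX : ∀ p ∈ (Finset.range 2 ×ˢ Finset.range 2 : Finset (ℕ × ℕ)),
          (X : k⟦X⟧) ^ gridValue (2 * h - 1) 1 p.1 p.2 ∈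
            semigroupPowerSeries k (bresinskySemigroup h) := by
        intro p hp s hs
        rw [Finset.mem_product, Finset.mem_range, Finset.mem_range] at hp
        rw [coeff_X_pow] at hs
        obtain rfl : s = _ := by
          by_contra hne
          exact hs (if_neg hne)
        exact generator_mem_bresinskySemigroup hh hp.1 hp.2
      have hf' : f = ∑ p ∈ (Finset.range 2 ×ˢ Finset.range 2 : Finset (ℕ × ℕ)).attach,
          (⟨_, hX p.1 p.2⟩ : semigroupPowerSeries k (bresinskySemigroup h)) * ⟨c p.1, hcR p.1⟩ := by
        refine Subtype.ext ?_
        rw [AddSubmonoidClass.coe_finsetSum, hsum, ← Finset.sum_attach]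
        rfl
      rw [hf', pow_succ']
      refine Submodule.sum_mem _ fun p _ => Ideal.mul_mem_mul ?_ (ih _ (hc p.1))
      rw [mem_maximalIdeal_semigroupPowerSeries]
      have hpos : gridValue (2 * h - 1) 1 p.1.1 p.1.2 ≠ 0 := by
        have : 0 < (2 * h - 1 + 1) * (2 * h - 1) := Nat.mul_pos (by omega) (by omega)
        simp only [gridValue]
        omega
      simp [hpos]

/-! ### Graded components and the Hilbert series -/

/-- The coefficients of a series at the elements of order exactly `n`. -/
noncomputable def initialCoeffs (k : Type*) [Field k] (h n : ℕ) :
    ↥(IsLocalRing.maximalIdeal (semigroupPowerSeries k (bresinskySemigroup h)) ^ n) →ₗ[k]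
      (Fin (min (2 * h) (n + 1)) × Fin (min (2 * h - 1) (n + 1)) → k) where
  toFun f p := coeff (gridValue (2 * h - 1) n p.1 p.2) (f.1 : k⟦X⟧)
  map_add' f g := by
    ext p
    simp
  map_smul' c f := by
    ext p
    exact coeff_smul _ _ _

theorem gridValue_fin_injective {h : ℕ} (hh : 2 ≤ h) (n : ℕ) :
    Function.Injective fun p : Fin (min (2 * h) (n + 1)) × Fin (min (2 * h - 1) (n + 1)) =>
      gridValue (2 * h - 1) n p.1 p.2 := by
  intro p p' e
  obtain ⟨-, h1, h2⟩ := gridValue_normal_form_unique (⟨h - 1, by omega⟩ : Odd (2 * h - 1))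
    (by omega) (by omega) (by omega) (by omega) e
  exact Prod.ext (Fin.ext h1) (Fin.ext h2)

theorem initialCoeffs_surjective (k : Type*) [Field k] {h : ℕ} (hh : 2 ≤ h) (n : ℕ) :
    Function.Surjective (initialCoeffs k h n) := by
  intro c
  have hinj := gridValue_fin_injective hh n
  set f : k⟦X⟧ := mk (Function.extend _ c 0) with hfdef
  have hf : ∀ s, coeff s f ≠ 0 → s ∈ orderFiltration (2 * h - 1) n := by
    intro s hs
    rw [hfdef, coeff_mk] at hs
    by_cases hex : ∃ p : Fin (min (2 * h) (n + 1)) × Fin (min (2 * h - 1) (n + 1)),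
        gridValue (2 * h - 1) n p.1 p.2 = s
    · obtain ⟨p, rfl⟩ := hex
      exact gridValue_mem_orderFiltration le_rfl (by omega) (by omega)
    · exact absurd (Function.extend_apply' _ _ _ hex) hs
  have hfR : f ∈ semigroupPowerSeries k (bresinskySemigroup h) := fun s hs =>
    (mem_bresinskySemigroup_iff hh s).2 (orderFiltration_antitone _ (Nat.zero_le n) (hf s hs))
  refine ⟨⟨⟨f, hfR⟩, (mem_maximalIdeal_pow_iff hh n _).2 hf⟩, ?_⟩
  ext p
  change coeff _ f = _
  rw [hfdef, coeff_mk]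
  exact hinj.extend_apply c 0 p

theorem ker_initialCoeffs (k : Type*) [Field k] {h : ℕ} (hh : 2 ≤ h) (n : ℕ) :
    LinearMap.ker (initialCoeffs k h n) =
      (IsLocalRing.maximalIdeal (semigroupPowerSeries k (bresinskySemigroup h)) • ⊤ :
        Submodule (semigroupPowerSeries k (bresinskySemigroup h))
          ↥(IsLocalRing.maximalIdeal (semigroupPowerSeries k (bresinskySemigroup h)) ^ n)
        ).restrictScalars k := by
  ext f
  have hodd : Odd (2 * h - 1) := ⟨h - 1, by omega⟩
  have hmem : f ∈ (IsLocalRing.maximalIdeal (semigroupPowerSeries k (bresinskySemigroup h)) • ⊤ :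
        Submodule (semigroupPowerSeries k (bresinskySemigroup h))
          ↥(IsLocalRing.maximalIdeal (semigroupPowerSeries k (bresinskySemigroup h)) ^ n)) ↔
      f.1 ∈ IsLocalRing.maximalIdeal (semigroupPowerSeries k (bresinskySemigroup h)) ^ (n + 1) := by
    rw [Submodule.mem_smul_top_iff, smul_eq_mul, pow_succ']
  rw [Submodule.restrictScalars_mem, hmem, mem_maximalIdeal_pow_iff hh, LinearMap.mem_ker]
  constructor
  · intro hf s hs
    obtain ⟨T, r, q, hT, hr, hq, hrT, hqT, rfl⟩ := exists_normal_form hodd.pos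
      ((mem_maximalIdeal_pow_iff hh n f.1).1 f.2 s hs)
    -- If `T = n`, the coefficient at `s` is one of those that vanish by `hf`.
    refine gridValue_mem_orderFiltration (Nat.lt_of_le_of_ne hT ?_) hrT hqT
    rintro rfl
    exact hs (congrFun hf (⟨r, by omega⟩, ⟨q, by omega⟩))
  · intro hf
    ext p
    by_contra hne
    obtain ⟨T, r, q, hT, hr, hq, -, -, e⟩ := exists_normal_form hodd.pos (hf _ hne)
    have := (gridValue_normal_form_unique hodd hr (by omega) hq (by omega) e).1
    omega

/-- A surjective `k`-linear map on `𝔪 ^ n` with kernel `𝔪 ^ (n + 1)` identifies the component of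
degree `n` of the tangent cone with its target. -/
noncomputable def tangentConeComponentEquivOfKer {k R W : Type*} [Field k] [CommRing R]
    [IsLocalRing R] [Algebra k R] [AddCommGroup W] [Module k W] {n : ℕ}
    (φ : ↥(IsLocalRing.maximalIdeal R ^ n) →ₗ[k] W) (hφ : Function.Surjective φ)
    (hker : LinearMap.ker φ = (IsLocalRing.maximalIdeal R • ⊤ :
      Submodule R ↥(IsLocalRing.maximalIdeal R ^ n)).restrictScalars k) :
    TangentConeComponent R n ≃ₗ[k] W :=
  (Submodule.Quotient.restrictScalarsEquiv k (IsLocalRing.maximalIdeal R • ⊤ :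
      Submodule R ↥(IsLocalRing.maximalIdeal R ^ n))).symm.trans
    ((Submodule.quotEquivOfEq _ _ hker.symm).trans (φ.quotKerEquivOfSurjective hφ))

/-- The component of degree `n` of the tangent cone of `k[[Γ_h]]` has a basis indexed by the
elements of `Γ_h` of order `n`. -/
noncomputable def tangentConeComponentEquiv (k : Type*) [Field k] {h : ℕ} (hh : 2 ≤ h) (n : ℕ) :
    TangentConeComponent (semigroupPowerSeries k (bresinskySemigroup h)) n ≃ₗ[k]
      (Fin (min (2 * h) (n + 1)) × Fin (min (2 * h - 1) (n + 1)) → k) :=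
  tangentConeComponentEquivOfKer (initialCoeffs k h n) (initialCoeffs_surjective k hh n)
    (ker_initialCoeffs k hh n)

theorem finrank_tangentConeComponent (k : Type*) [Field k] {h : ℕ} (hh : 2 ≤ h) (n : ℕ) :
    Module.finrank k (TangentConeComponent (semigroupPowerSeries k (bresinskySemigroup h)) n) =
      min (2 * h) (n + 1) * min (2 * h - 1) (n + 1) := by
  rw [(tangentConeComponentEquiv k hh n).finrank_eq]
  simp

theorem mainTheorem5 (k : Type*) [Field k] (h : ℕ) (hh : 2 ≤ h) :
    (∀ n, Module.Finite k
      (TangentConeComponent (semigroupPowerSeries k (bresinskySemigroup h)) n)) ∧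
    hilbertSeries k (TangentConeComponent (semigroupPowerSeries k (bresinskySemigroup h))) *
        (1 - X) =
      (∑ j ∈ Finset.Icc 0 (2 * h - 2), C (2 * (j : ℤ) + 1) * X ^ j) +
        C (2 * (h : ℤ) - 1) * X ^ (2 * h - 1) := by
  refine ⟨fun n => Module.Finite.equiv (tangentConeComponentEquiv k hh n).symm, ?_⟩
  ext n
  rw [mul_sub, mul_one, map_sub, map_add, map_sum]
  simp only [coeff_C_mul, coeff_X_pow, mul_ite, mul_one, mul_zero, Finset.sum_ite_eq,
    Finset.mem_Icc, Nat.zero_le, true_and, hilbertSeries]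
  rcases n with _ | n
  · rw [coeff_zero_mul_X, coeff_mk, finrank_tangentConeComponent k hh,
      min_eq_right (by omega), min_eq_right (by omega), if_pos (by omega), if_neg (by omega)]
    simp
  · rw [coeff_succ_mul_X, coeff_mk, coeff_mk, finrank_tangentConeComponent k hh,
      finrank_tangentConeComponent k hh]
    -- The difference of consecutive dimensions is `(n + 2)² - (n + 1)²`, then `(K + 1) K - K²`,
    -- then `0`.
    rcases lt_trichotomy (n + 1) (2 * h - 1) with hlt | heq | hgt
    · rw [min_eq_right (by omega), min_eq_right (by omega), min_eq_right (by omega),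
        min_eq_right (by omega), if_pos (by omega), if_neg (by omega)]
      push_cast
      ring
    · rw [min_eq_right (by omega), min_eq_left (by omega), min_eq_right (by omega),
        min_eq_right (by omega), if_neg (by omega), if_pos heq, ← heq]
      have : (2 * h : ℤ) = n + 2 := by omega
      rw [this]
      push_cast
      ring
    · rw [min_eq_left (by omega), min_eq_left (by omega), min_eq_left (by omega),
        min_eq_left (by omega), if_neg (by omega), if_neg (by omega)]
      ring
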